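/- \textbf{Theorem (Hardy's theorem for Hermite expansions).} Let $n\ge 1$ and let $H=-\Delta+|x|^2$ be the Hermite operator on $L^2(\mathbb R^n)$ (complex-valued functions), in its self-adjoint realisation, i.e. the adjoint of $-\Delta+|x|^2$ on the Schwartz space. For $k=0,1,2,\dots$ let $P_k$ be the orthogonal projection of $L^2(\mathbb R^n)$ onto the eigenspace $\{f\in L^2(\mathbb R^n): Hf=(2k+n)f\}$. Let $f\in L^2(\mathbb R^n)$, $a,b>0$ and a constant $C$ be such that $$|f(x)|\le C\,e^{-\frac12 a|x|^2}\quad\text{for almost every } x\in\mathbb R^n,$$ $$\|P_kf\|_2\le C\,e^{-\frac12 b(2k+n)}\quad\text{for all } k\ge 0.$$ If $a\tanh b>1$, then $f=0$ (almost everywhere). -/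

import Mathlib

open MeasureTheory
open scoped SchwartzMap Laplacian InnerProductSpace

noncomputable section

namespace HermiteExpansion

/-- The complex Hilbert space `L²(ℝⁿ)` with respect to Lebesgue measure. -/
abbrev L2 (n : ℕ) : Type := Lp ℂ 2 (volume : Measure (EuclideanSpace ℝ (Fin n)))

/-- The Hermite operator `H = -Δ + |x|²` on Schwartz functions. -/
def hermiteOp (n : ℕ) (φ : 𝓢(EuclideanSpace ℝ (Fin n), ℂ)) : 𝓢(EuclideanSpace ℝ (Fin n), ℂ) :=
  -(Δ φ) + SchwartzMap.smulLeftCLM ℂ (fun x : EuclideanSpace ℝ (Fin n) => ‖x‖ ^ 2) φ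

theorem hermiteOp_apply (n : ℕ) (φ : 𝓢(EuclideanSpace ℝ (Fin n), ℂ))
    (x : EuclideanSpace ℝ (Fin n)) :
    hermiteOp n φ x =
      -(Δ (φ : EuclideanSpace ℝ (Fin n) → ℂ) x) + ((‖x‖ ^ 2 : ℝ) : ℂ) * φ x := by
  have h := SchwartzMap.smulLeftCLM_apply_apply (F := ℂ)
    (Function.hasTemperateGrowth_norm_sq (H := EuclideanSpace ℝ (Fin n))) φ x
  simp only [hermiteOp, _root_.add_apply, _root_.neg_apply,
    SchwartzMap.laplacian_apply, h, Complex.real_smul]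

/-- The eigenspace in `L²(ℝⁿ)` of the Hermite operator `H` with eigenvalue `μ`: the functions
`f ∈ L²(ℝⁿ)` that lie in the domain of the adjoint of `H` on Schwartz functions (which is the
self-adjoint realisation of `H`, that is, `Hf` taken in the sense of distributions) and satisfy
`Hf = μ f`. -/
def hermiteEigenspace (n : ℕ) (μ : ℝ) : ClosedSubmodule ℂ (L2 n) where
  carrier := {f | ∀ φ : 𝓢(EuclideanSpace ℝ (Fin n), ℂ),
    ⟪(hermiteOp n φ).toLp 2 volume, f⟫_ℂ = (μ : ℂ) * ⟪φ.toLp 2 volume, f⟫_ℂ}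
  add_mem' := by
    intro f g hf hg φ
    rw [inner_add_right, inner_add_right, hf φ, hg φ, mul_add]
  zero_mem' := by
    intro φ
    simp
  smul_mem' := by
    intro c f hf φ
    rw [inner_smul_right, inner_smul_right, hf φ, mul_left_comm]
  isClosed' := by
    simp only [Set.ofPred_forall]
    exact isClosed_iInter fun φ => isClosed_eq (by fun_prop) (by fun_prop)

/-- `P_k`: the orthogonal projection of `L²(ℝⁿ)` onto the eigenspace of the Hermite operator
with eigenvalue `2k + n`. -/
def hermiteProj (n k : ℕ) : L2 n →L[ℂ] L2 n :=
  (hermiteEigenspace n (2 * (k : ℝ) + (n : ℝ))).toSubmodule.starProjection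

end HermiteExpansion

end

/-!
For `w ∈ ℝⁿ` let `F_w(z)` be the pairing of `f` with the coherent state
`exp (2 z ⟪w, x⟫ - z ^ 2 ‖w‖ ^ 2) exp (-‖x‖ ^ 2 / 2)`. Its Taylor coefficients at `0` are
`⟪f, h_k⟫ / k!`, where `h_k`, the `k`-th power of the creation operator `⟪w, x⟫ - ∂_w` applied to
the Gaussian, is an eigenfunction of `H` for the eigenvalue `2k + n`. Hence the decay of `P_k f`
makes `F_w` an entire function of order `2` and type at most `e^(-2b) ‖w‖ ^ 2`, while the Gaussian
decay of `f` makes `F_w` decay on the real axis like `exp (-(a - 1) / (a + 1) ‖w‖ ^ 2 t ^ 2)`. Since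
`a tanh b > 1` means `e^(-2b) < (a - 1) / (a + 1)`, the Phragmén-Lindelöf principle forces
`F_w = 0`. The numbers `F_w(i)` are, up to nonzero factors, the values of the Fourier transform of
the product of the Gaussian with the conjugate of `f`, so `f = 0`.
-/

namespace HermiteExpansion

open Complex
open scoped Real LineDeriv ContDiff

section PhragmenLindelof

variable {V : Type*} [NormedAddCommGroup V] [NormedSpace ℂ V]

theorem norm_le_of_norm_le_on_rays {G : ℂ → V} (hG : Differentiable ℂ G) {A B C ρ α β : ℝ}
    (hρ : 0 ≤ ρ) (hρ' : ρ < π / (β - α)) (hGgrowth : ∀ z, ‖G z‖ ≤ A * rexp (B * ‖z‖ ^ ρ))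
    (hα : ∀ r : ℝ, 0 < r → ‖G (r * cexp (α * I))‖ ≤ C)
    (hβ : ∀ r : ℝ, 0 < r → ‖G (r * cexp (β * I))‖ ≤ C)
    {r θ : ℝ} (hr : 0 < r) (hθ : θ ∈ Set.Icc α β) : ‖G (r * cexp (θ * I))‖ ≤ C := by
  have exp_polar (ζ : ℂ) : cexp ζ = (Real.exp ζ.re : ℝ) * cexp (ζ.im * I) := by
    rw [ofReal_exp, ← Complex.exp_add, re_add_im]
  have growth : (fun ζ => G (cexp ζ)) =O[Filter.comap (|re ·|) Filter.atTop ⊓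
      Filter.principal (im ⁻¹' Set.Ioo α β)] fun ζ => rexp (|B| * rexp (ρ * |ζ.re|)) := by
    refine .of_bound |A| (.of_forall fun ζ => (hGgrowth _).trans ?_)
    rw [Real.norm_eq_abs, Real.abs_exp, Complex.norm_exp, ← Real.exp_mul, mul_comm ζ.re]
    gcongr <;> exact le_abs_self _
  have hstrip := PhragmenLindelof.horizontal_strip (f := fun ζ => G (cexp ζ)) (C := C)
    (z := Real.log r + θ * I) (hG.comp differentiable_exp).diffContOnCl ⟨ρ, hρ', |B|, growth⟩
    (fun ζ hζ => by rw [exp_polar, hζ]; exact hα _ (Real.exp_pos _))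
    (fun ζ hζ => by rw [exp_polar, hζ]; exact hβ _ (Real.exp_pos _))
    (by simpa using hθ.1) (by simpa using hθ.2)
  simpa [Complex.exp_add, ← ofReal_log hr.le, ← ofReal_exp, Real.exp_log hr] using hstrip

theorem norm_cexp_polar_sq_smul_le_iff {p q r θ C : ℝ} {v : V} :
    ‖cexp ((p - q * I) * (r * cexp (θ * I)) ^ 2) • v‖ ≤ C ↔
      ‖v‖ ≤ C * rexp (-(p * Real.cos (2 * θ) + q * Real.sin (2 * θ)) * r ^ 2) := by
  have polar_sq : (r * cexp (θ * I)) ^ 2 =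
      ((r ^ 2 : ℝ) : ℂ) * ((Real.cos (2 * θ) : ℝ) + (Real.sin (2 * θ) : ℝ) * I) := by
    rw [mul_pow, ← Complex.exp_nat_mul, ofReal_cos, ofReal_sin, ← Complex.exp_mul_I]
    push_cast
    ring_nf
  have exponent_re : ((p - q * I) * (r * cexp (θ * I)) ^ 2).re =
      (p * Real.cos (2 * θ) + q * Real.sin (2 * θ)) * r ^ 2 := by
    rw [polar_sq]
    simp only [mul_re, mul_im, sub_re, sub_im, add_re, add_im, ofReal_re, ofReal_im, I_re, I_im]
    ring
  rw [norm_smul, Complex.norm_exp, exponent_re, neg_mul, Real.exp_neg, ← div_eq_mul_inv,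
    le_div_iff₀' (Real.exp_pos _)]

theorem norm_le_on_first_quadrant {F : ℂ → V} (hF : Differentiable ℂ F) {C α β : ℝ}
    (hgrowth : ∀ z, ‖F z‖ ≤ C * rexp (β * ‖z‖ ^ 2))
    (hdecay : ∀ x : ℝ, 0 < x → ‖F x‖ ≤ C * rexp (-α * x ^ 2)) (hβα : β < α) (q : ℝ)
    {r θ : ℝ} (hr : 0 < r) (hθ : θ ∈ Set.Ico 0 (π / 2)) :
    ‖F (r * cexp (θ * I))‖ ≤
      C * rexp (-(α * Real.cos (2 * θ) + q * Real.sin (2 * θ)) * r ^ 2) := by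
  -- For small `t` the factor `exp ((α - q I) z ^ 2)` beats the growth of `F` on the ray at angle
  -- `π / 2 - t / 2`, and the sector below that ray is narrow enough for a function of order `2`.
  obtain ⟨t, ⟨ht, hθt⟩, ht0⟩ :
      ∃ t, (β < α * Real.cos t - q * Real.sin t ∧ t < π - 2 * θ) ∧ 0 < t := by
    have hcont : ContinuousAt (fun t => α * Real.cos t - q * Real.sin t) 0 := by fun_prop
    have hnear := hcont.eventually_const_lt (u := β) (by simpa using hβα)
    have hsmall := Iio_mem_nhds (show 0 < π - 2 * θ by linarith [hθ.2])
    exact ((hnear.and hsmall).filter_mono (nhdsWithin_le_nhds (s := Set.Ioi 0)) |>.and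
      self_mem_nhdsWithin).exists
  rw [← norm_cexp_polar_sq_smul_le_iff]
  refine norm_le_of_norm_le_on_rays (G := fun z => cexp ((α - q * I) * z ^ 2) • F z)
    (A := C) (B := ‖(α - q * I : ℂ)‖ + β) (ρ := 2) (α := 0) (β := π / 2 - t / 2)
    (by fun_prop) zero_le_two ?_ (fun z => ?_) (fun r hr => ?_) (fun r hr => ?_) hr
    ⟨hθ.1, by linarith⟩
  · rw [lt_div_iff₀] <;> linarith [hθ.1]
  · rw [norm_smul, Real.rpow_two, add_mul, Real.exp_add, mul_left_comm]
    gcongr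
    · exact (norm_exp_le_exp_norm _).trans_eq (by rw [norm_mul, norm_pow])
    · exact hgrowth z
  · rw [norm_cexp_polar_sq_smul_le_iff]
    simpa using hdecay r hr
  · rw [norm_cexp_polar_sq_smul_le_iff, show 2 * (π / 2 - t / 2) = π - t by ring,
      Real.cos_pi_sub, Real.sin_pi_sub]
    have hC : 0 ≤ C := nonneg_of_mul_nonneg_left ((norm_nonneg _).trans (hgrowth 0))
      (Real.exp_pos _)
    refine (hgrowth _).trans ?_
    rw [norm_mul, norm_exp_ofReal_mul_I, mul_one, norm_real, Real.norm_eq_abs, sq_abs]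
    gcongr
    linarith

theorem eq_zero_of_gaussian_decay_of_gaussian_growth [CompleteSpace V] {F : ℂ → V}
    (hF : Differentiable ℂ F) {C₁ C₂ α β : ℝ}
    (hgrowth : ∀ z, ‖F z‖ ≤ C₁ * rexp (β * ‖z‖ ^ 2))
    (hdecay : ∀ x : ℝ, 0 < x → ‖F x‖ ≤ C₂ * rexp (-α * x ^ 2)) (hβα : β < α) : F = 0 := by
  have hbound (q : ℝ) {r θ : ℝ} (hr : 0 < r) (hθ : θ ∈ Set.Ico 0 (π / 2)) :=
    norm_le_on_first_quadrant hF (C := max C₁ C₂)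
      (fun z => (hgrowth z).trans (by gcongr; exact le_max_left ..))
      (fun x hx => (hdecay x hx).trans (by gcongr; exact le_max_right ..)) hβα q hr hθ
  have hquadrant (r θ : ℝ) (hr : 0 < r) (hθ : θ ∈ Set.Ioo 0 (π / 2)) :
      F (r * cexp (θ * I)) = 0 := by
    have hsin : 0 < Real.sin (2 * θ) :=
      Real.sin_pos_of_pos_of_lt_pi (by linarith [hθ.1]) (by linarith [hθ.2])
    have hlim : Filter.Tendsto (fun q => max C₁ C₂ *
        rexp (-(α * Real.cos (2 * θ) + q * Real.sin (2 * θ)) * r ^ 2)) Filter.atTop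
        (nhds (max C₁ C₂ * 0)) := by
      refine (Real.tendsto_exp_atBot.comp (Filter.Tendsto.atBot_mul_const (by positivity)
        (Filter.tendsto_neg_atTop_atBot.comp ?_))).const_mul _
      exact Filter.tendsto_atTop_add_const_left _ _ (Filter.tendsto_id.atTop_mul_const hsin)
    rw [mul_zero] at hlim
    exact norm_le_zero_iff.1 (ge_of_tendsto' hlim fun q => hbound q hr (Set.Ioo_subset_Ico_self hθ))
  refine (hF.differentiableOn.analyticOnNhd isOpen_univ).eq_of_eventuallyEq (z₀ := 1 + I)
    analyticOnNhd_const ?_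
  have hopen : IsOpen {z : ℂ | 0 < z.re ∧ 0 < z.im} :=
    (isOpen_lt continuous_const continuous_re).inter (isOpen_lt continuous_const continuous_im)
  filter_upwards [hopen.mem_nhds (show 0 < (1 + I).re ∧ 0 < (1 + I).im by simp)] with z hz
  have hz0 : z ≠ 0 := by rintro rfl; simp at hz
  have harg_pos : 0 < arg z := (arg_nonneg_iff.2 hz.2.le).lt_of_ne' fun h =>
    hz.2.ne' (arg_eq_zero_iff.1 h).2
  have harg_lt : arg z < π / 2 := arg_lt_pi_div_two_iff.2 (.inl hz.1)
  rw [← norm_mul_exp_arg_mul_I z]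
  exact hquadrant _ _ (norm_pos_iff.2 hz0) ⟨harg_pos, harg_lt⟩

end PhragmenLindelof

section PowerSeries

theorem pow_div_sqrt_factorial_le {y θ : ℝ} (hθ : 0 < θ) (k : ℕ) :
    y ^ k / √(k.factorial) ≤ θ ^ k * rexp (y ^ 2 / (2 * θ ^ 2)) := by
  refine le_of_sq_le_sq ?_ (by positivity)
  calc (y ^ k / √(k.factorial)) ^ 2 = (θ ^ k) ^ 2 * ((y ^ 2 / θ ^ 2) ^ k / k.factorial) := by
        rw [div_pow, div_pow, Real.sq_sqrt (by positivity), pow_right_comm y, pow_right_comm θ]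
        field_simp
    _ ≤ (θ ^ k) ^ 2 * rexp (y ^ 2 / θ ^ 2) := by
        gcongr
        exact Real.pow_div_factorial_le_exp _ (by positivity) k
    _ = (θ ^ k * rexp (y ^ 2 / (2 * θ ^ 2))) ^ 2 := by
        rw [mul_pow, ← Real.exp_nat_mul]
        congr 2
        field_simp
        norm_num

theorem summable_pow_div_sqrt_factorial (y : ℝ) :
    Summable fun k : ℕ => y ^ k / √(k.factorial) := by
  refine .of_norm_bounded (summable_geometric_two.mul_right (rexp (y ^ 2 / (2 * (1 / 2) ^ 2))))
    fun k => ?_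
  rw [norm_div, norm_pow, Real.norm_of_nonneg (Real.sqrt_nonneg _), Real.norm_eq_abs, ← sq_abs y]
  exact pow_div_sqrt_factorial_le one_half_pos k

variable {V : Type*} [NormedAddCommGroup V] [NormedSpace ℂ V] {F : ℂ → V} {a : ℕ → V}

theorem differentiable_of_hasSum_pow_smul [CompleteSpace V]
    (hF : ∀ z : ℂ, HasSum (fun k => z ^ k • a k) (F z)) : Differentiable ℂ F := by
  let p : FormalMultilinearSeries ℂ ℂ V := fun k => .mkPiRing ℂ (Fin k) (a k)
  have radius_eq_top : p.radius = ⊤ := ENNReal.eq_top_of_forall_nnreal_le fun r => by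
    have hterms := (hF (r : ℝ)).summable.tendsto_atTop_zero.norm
    simp only [norm_smul, norm_pow, norm_real, NNReal.norm_eq] at hterms
    refine p.le_radius_of_tendsto (l := ‖(0 : V)‖) ?_
    simpa only [p, ContinuousMultilinearMap.norm_mkPiRing, mul_comm] using hterms
  have hseries : HasFPowerSeriesOnBall F p 0 ⊤ :=
    ⟨radius_eq_top.ge, ENNReal.zero_lt_top, fun {z} _ => by simpa [p] using hF z⟩
  simpa [differentiableOn_univ] using hseries.differentiableOn

theorem norm_le_of_hasSum_pow_smul (hF : ∀ z : ℂ, HasSum (fun k => z ^ k • a k) (F z))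
    {D σ θ : ℝ} (ha : ∀ k, ‖a k‖ ≤ D * (σ ^ k / √(k.factorial)))
    (hθ : 0 < θ) (hθ1 : θ < 1) (z : ℂ) :
    ‖F z‖ ≤ D * (1 - θ)⁻¹ * rexp (σ ^ 2 / (2 * θ ^ 2) * ‖z‖ ^ 2) := by
  have hD : 0 ≤ D := (norm_nonneg _).trans (by simpa using ha 0)
  rw [← (hF z).tsum_eq]
  refine tsum_of_norm_bounded
    (((hasSum_geometric_of_lt_one hθ.le hθ1).mul_left D).mul_right _) fun k => ?_
  calc ‖z ^ k • a k‖ ≤ ‖z‖ ^ k * (D * (σ ^ k / √(k.factorial))) := by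
        rw [norm_smul, norm_pow]
        gcongr
        exact ha k
    _ = D * ((σ * ‖z‖) ^ k / √(k.factorial)) := by ring
    _ ≤ D * (θ ^ k * rexp ((σ * ‖z‖) ^ 2 / (2 * θ ^ 2))) := by
        gcongr
        exact pow_div_sqrt_factorial_le hθ k
    _ = D * θ ^ k * rexp (σ ^ 2 / (2 * θ ^ 2) * ‖z‖ ^ 2) := by ring_nf

end PowerSeries

section Gaussian

theorem exists_norm_pow_mul_iteratedFDeriv_exp_le {E : Type*} [NormedAddCommGroup E]
    [NormedSpace ℝ E] {u : E → ℝ} (hu : u.HasTemperateGrowth)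
    (hexp : ∀ N : ℕ, ∃ C, ∀ x, (1 + ‖x‖) ^ N * rexp (u x) ≤ C) (k m : ℕ) :
    ∃ C, ∀ x, ‖x‖ ^ k * ‖iteratedFDeriv ℝ m (fun y => rexp (u y)) x‖ ≤ C := by
  obtain ⟨l, K, hK, hu_le⟩ := hu.norm_iteratedFDeriv_le_uniform m
  obtain ⟨C, hC⟩ := hexp (k + l * m)
  refine ⟨m.factorial * (K + 1) ^ m * C, fun x => ?_⟩
  have one_le : 1 ≤ (K + 1) * (1 + ‖x‖) ^ l :=
    one_le_mul_of_one_le_of_one_le (by linarith) (one_le_pow₀ (by linarith [norm_nonneg x]))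
  have hderiv : ‖iteratedFDeriv ℝ m (fun y => rexp (u y)) x‖ ≤
      m.factorial * rexp (u x) * ((K + 1) * (1 + ‖x‖) ^ l) ^ m := by
    refine norm_iteratedFDeriv_comp_le (N := ∞) Real.contDiff_exp hu.1 (mod_cast le_top) x
      (fun i _ => ?_) fun i hi him => ?_
    · rw [norm_iteratedFDeriv_eq_norm_iteratedDeriv, iteratedDeriv_eq_iterate,
        Real.iter_deriv_exp, Real.norm_eq_abs, Real.abs_exp]
    · refine (hu_le i him x).trans (le_trans ?_ (le_self_pow₀ one_le (by omega)))
      gcongr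
      linarith
  calc ‖x‖ ^ k * ‖iteratedFDeriv ℝ m (fun y => rexp (u y)) x‖
      ≤ (1 + ‖x‖) ^ k * (m.factorial * rexp (u x) * ((K + 1) * (1 + ‖x‖) ^ l) ^ m) := by
        gcongr
        linarith
    _ = m.factorial * (K + 1) ^ m * ((1 + ‖x‖) ^ (k + l * m) * rexp (u x)) := by
        rw [mul_pow, ← pow_mul, pow_add]
        ring
    _ ≤ m.factorial * (K + 1) ^ m * C := by
        gcongr
        exact hC x

theorem one_add_pow_mul_exp_neg_sq_le (N : ℕ) {t : ℝ} (ht : 0 ≤ t) :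
    (1 + t) ^ N * rexp (-(t ^ 2 / 2)) ≤ N.factorial * rexp (3 / 2) := by
  have hpow : (1 + t) ^ N ≤ N.factorial * rexp (1 + t) :=
    (div_le_iff₀' (by positivity)).1 (Real.pow_div_factorial_le_exp (1 + t) (by positivity) N)
  calc (1 + t) ^ N * rexp (-(t ^ 2 / 2))
      ≤ N.factorial * rexp (1 + t) * rexp (-(t ^ 2 / 2)) := by gcongr
    _ = N.factorial * rexp (1 + t + -(t ^ 2 / 2)) := by rw [mul_assoc, ← Real.exp_add]
    _ ≤ N.factorial * rexp (3 / 2) := by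
        gcongr
        nlinarith [sq_nonneg (t - 1)]

variable {E : Type*} [NormedAddCommGroup E] [InnerProductSpace ℝ E]

theorem hasTemperateGrowth_neg_norm_sq_div_two :
    (fun x : E => -(‖x‖ ^ 2 / 2)).HasTemperateGrowth := by
  simp only [div_eq_mul_inv]
  fun_prop

variable (E) in
/-- The Gaussian `x ↦ exp (-‖x‖ ^ 2 / 2)`, the ground state of the Hermite operator, as a Schwartz
function. -/
noncomputable def gaussian : 𝓢(E, ℂ) :=
  SchwartzMap.postcompCLM ofRealCLM
    { toFun := fun x => rexp (-(‖x‖ ^ 2 / 2))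
      smooth' := hasTemperateGrowth_neg_norm_sq_div_two.1.exp
      decay' := fun k m =>
        exists_norm_pow_mul_iteratedFDeriv_exp_le hasTemperateGrowth_neg_norm_sq_div_two
          (fun N => ⟨_, fun x => one_add_pow_mul_exp_neg_sq_le N (norm_nonneg x)⟩) k m }

theorem gaussian_apply (x : E) : gaussian E x = (rexp (-(‖x‖ ^ 2 / 2)) : ℝ) := rfl

theorem gaussian_ne_zero (x : E) : gaussian E x ≠ 0 := by
  simpa only [gaussian_apply] using ofReal_ne_zero.2 (Real.exp_pos _).ne'

end Gaussian

section Ladder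

theorem lineDerivOp_comm {E F : Type*} [NormedAddCommGroup E] [NormedSpace ℝ E]
    [NormedAddCommGroup F] [NormedSpace ℝ F] (v w : E) (φ : 𝓢(E, F)) :
    ∂_{v} (∂_{w} φ) = ∂_{w} (∂_{v} φ) := by
  have hessian (v w x : E) : ∂_{v} (∂_{w} φ) x = fderiv ℝ (fderiv ℝ φ) x v w := by
    have := SchwartzMap.iteratedLineDerivOp_eq_iteratedFDeriv (m := ![v, w]) (f := φ) (x := x)
    simpa [iteratedFDeriv_two_apply, LineDeriv.iteratedLineDerivOp_succ_left] using this
  ext x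
  rw [hessian, hessian]
  exact (φ.smooth 2).contDiffAt.isSymmSndFDerivAt (by simp) v w

variable {E : Type*} [NormedAddCommGroup E] [InnerProductSpace ℝ E]

/-- The position operator in direction `w`: multiplication of Schwartz functions by `⟪w, ·⟫`. -/
noncomputable def mulInner (w : E) : 𝓢(E, ℂ) →L[ℝ] 𝓢(E, ℂ) :=
  SchwartzMap.smulLeftCLM ℂ fun x => ⟪w, x⟫_ℝ

@[simp]
theorem mulInner_apply (w : E) (φ : 𝓢(E, ℂ)) (x : E) : mulInner w φ x = ⟪w, x⟫_ℝ * φ x := by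
  rw [mulInner, SchwartzMap.smulLeftCLM_apply_apply (by fun_prop), real_smul]

variable (E) in
/-- The potential of the Hermite operator: multiplication of Schwartz functions by `‖x‖ ^ 2`. -/
noncomputable def mulNormSq : 𝓢(E, ℂ) →L[ℝ] 𝓢(E, ℂ) :=
  SchwartzMap.smulLeftCLM ℂ fun x => ‖x‖ ^ 2

@[simp]
theorem mulNormSq_apply (φ : 𝓢(E, ℂ)) (x : E) : mulNormSq E φ x = ((‖x‖ ^ 2 : ℝ) : ℂ) * φ x := by
  rw [mulNormSq, SchwartzMap.smulLeftCLM_apply_apply (by fun_prop), real_smul]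

theorem mulNormSq_mulInner (w : E) (φ : 𝓢(E, ℂ)) :
    mulNormSq E (mulInner w φ) = mulInner w (mulNormSq E φ) := by
  ext x
  simp only [mulInner_apply, mulNormSq_apply, mul_left_comm]

theorem lineDerivOp_mulInner (v w : E) (φ : 𝓢(E, ℂ)) :
    ∂_{v} (mulInner w φ) = ⟪w, v⟫_ℝ • φ + mulInner w (∂_{v} φ) := by
  ext x
  have hderiv := ((innerSL ℝ w).hasFDerivAt (x := x)).smul (φ.hasFDerivAt x)
  have hfun : (mulInner w φ : E → ℂ) = (innerSL ℝ w : E → ℝ) • (φ : E → ℂ) := by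
    ext y
    simp
  rw [SchwartzMap.lineDerivOp_apply_eq_fderiv, hfun, hderiv.fderiv]
  simp [SchwartzMap.lineDerivOp_apply_eq_fderiv, add_comm]

theorem lineDerivOp_mulNormSq (v : E) (φ : 𝓢(E, ℂ)) :
    ∂_{v} (mulNormSq E φ) = (2 : ℝ) • mulInner v φ + mulNormSq E (∂_{v} φ) := by
  ext x
  have hderiv := (hasStrictFDerivAt_norm_sq x).hasFDerivAt.smul (φ.hasFDerivAt x)
  have hfun : (mulNormSq E φ : E → ℂ) = (fun x : E => ‖x‖ ^ 2) • (φ : E → ℂ) := by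
    ext y
    simp
  rw [SchwartzMap.lineDerivOp_apply_eq_fderiv, hfun, hderiv.fderiv]
  simp [SchwartzMap.lineDerivOp_apply_eq_fderiv, real_inner_comm, add_comm, mul_assoc]

theorem lineDerivOp_gaussian (v : E) : ∂_{v} (gaussian E) = -mulInner v (gaussian E) := by
  ext x
  have hderiv : HasFDerivAt (gaussian E) _ x := ofRealCLM.hasFDerivAt.comp x
    ((hasStrictFDerivAt_norm_sq x).hasFDerivAt.mul_const (2⁻¹ : ℝ)).neg.exp
  rw [SchwartzMap.lineDerivOp_apply_eq_fderiv, hderiv.fderiv]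
  simp [gaussian_apply, real_inner_comm, mul_comm, div_eq_mul_inv]

/-- The creation operator `⟪w, x⟫ - ∂_w`. -/
noncomputable def creation (w : E) : 𝓢(E, ℂ) →L[ℝ] 𝓢(E, ℂ) :=
  mulInner w - LineDeriv.lineDerivOpCLM ℝ 𝓢(E, ℂ) w

/-- The annihilation operator `⟪w, x⟫ + ∂_w`. -/
noncomputable def annihilation (w : E) : 𝓢(E, ℂ) →L[ℝ] 𝓢(E, ℂ) :=
  mulInner w + LineDeriv.lineDerivOpCLM ℝ 𝓢(E, ℂ) w

theorem creation_apply (w : E) (φ : 𝓢(E, ℂ)) : creation w φ = mulInner w φ - ∂_{w} φ := rfl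

theorem annihilation_apply (w : E) (φ : 𝓢(E, ℂ)) :
    annihilation w φ = mulInner w φ + ∂_{w} φ := rfl

theorem annihilation_creation (w : E) (φ : 𝓢(E, ℂ)) :
    annihilation w (creation w φ) = creation w (annihilation w φ) + (2 * ‖w‖ ^ 2) • φ := by
  simp only [annihilation_apply, creation_apply, map_sub, map_add, lineDerivOp_mulInner,
    real_inner_self_eq_norm_sq]
  module

/-- The Hermite functions in direction `w`, up to normalisation: the states obtained by repeatedly
applying the creation operator to the Gaussian. -/
noncomputable def hermiteFun (w : E) : ℕ → 𝓢(E, ℂ)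
  | 0 => gaussian E
  | k + 1 => creation w (hermiteFun w k)

theorem annihilation_gaussian (w : E) : annihilation w (gaussian E) = 0 := by
  rw [annihilation_apply, lineDerivOp_gaussian, add_neg_cancel]

theorem annihilation_hermiteFun_succ (w : E) (k : ℕ) :
    annihilation w (hermiteFun w (k + 1)) = (2 * ‖w‖ ^ 2 * (k + 1)) • hermiteFun w k := by
  induction k with
  | zero => simp [hermiteFun, annihilation_creation, annihilation_gaussian]
  | succ k ih =>
    rw [hermiteFun, annihilation_creation, ih, map_smul, ← hermiteFun]
    push_cast
    module

variable [FiniteDimensional ℝ E]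

theorem laplacian_mulInner (w : E) (φ : 𝓢(E, ℂ)) :
    Δ (mulInner w φ) = mulInner w (Δ φ) + (2 : ℝ) • ∂_{w} φ := by
  have lineDerivOp_eq_sum :
      ∂_{w} φ = ∑ i, ⟪w, stdOrthonormalBasis ℝ E i⟫_ℝ • ∂_{stdOrthonormalBasis ℝ E i} φ := by
    conv_lhs => rw [← (stdOrthonormalBasis ℝ E).sum_repr' w]
    ext x
    simp [SchwartzMap.lineDerivOp_apply_eq_fderiv, real_inner_comm]
  simp only [SchwartzMap.laplacian_eq_sum (stdOrthonormalBasis ℝ E), lineDerivOp_mulInner,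
    LineDeriv.lineDerivOp_add, LineDeriv.lineDerivOp_smul, map_sum, Finset.sum_add_distrib,
    lineDerivOp_eq_sum]
  module

theorem laplacian_lineDerivOp (w : E) (φ : 𝓢(E, ℂ)) : Δ (∂_{w} φ) = ∂_{w} (Δ φ) := by
  simp only [SchwartzMap.laplacian_eq_sum (stdOrthonormalBasis ℝ E), LineDeriv.lineDerivOp_sum,
    lineDerivOp_comm _ w]

theorem laplacian_gaussian :
    Δ (gaussian E) = mulNormSq E (gaussian E) - (Module.finrank ℝ E : ℝ) • gaussian E := by
  simp only [SchwartzMap.laplacian_eq_sum (stdOrthonormalBasis ℝ E), lineDerivOp_gaussian,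
    LineDeriv.lineDerivOp_neg, lineDerivOp_mulInner, map_neg]
  ext x
  have parseval : ((‖x‖ ^ 2 : ℝ) : ℂ) =
      ∑ i, (⟪stdOrthonormalBasis ℝ E i, x⟫_ℝ : ℂ) * ⟪stdOrthonormalBasis ℝ E i, x⟫_ℝ := by
    simp only [← (stdOrthonormalBasis ℝ E).sum_sq_inner_right x, pow_two, ofReal_sum, ofReal_mul]
  simp [-ofReal_pow, parseval, Finset.sum_add_distrib, Finset.sum_mul, mul_assoc, sub_eq_add_neg]

end Ladder

section Eigenfunctions

variable {n : ℕ} (w : EuclideanSpace ℝ (Fin n))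

theorem hermiteOp_eq (φ : 𝓢(EuclideanSpace ℝ (Fin n), ℂ)) :
    hermiteOp n φ = -(Δ φ) + mulNormSq _ φ := rfl

theorem hermiteOp_creation (φ : 𝓢(EuclideanSpace ℝ (Fin n), ℂ)) :
    hermiteOp n (creation w φ) = creation w (hermiteOp n φ) + (2 : ℝ) • creation w φ := by
  have laplacian_sub (φ ψ : 𝓢(EuclideanSpace ℝ (Fin n), ℂ)) : Δ (φ - ψ) = Δ φ - Δ ψ := by
    simp only [← SchwartzMap.laplacianCLM_eq', map_sub]
  simp only [hermiteOp_eq, creation_apply, laplacian_sub, laplacian_mulInner,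
    laplacian_lineDerivOp, map_sub, map_add, map_neg, lineDerivOp_mulNormSq, mulNormSq_mulInner]
  module

theorem hermiteOp_hermiteFun (k : ℕ) :
    hermiteOp n (hermiteFun w k) = (2 * k + n : ℝ) • hermiteFun w k := by
  induction k with
  | zero =>
    rw [hermiteFun, hermiteOp_eq, laplacian_gaussian, finrank_euclideanSpace_fin]
    push_cast
    module
  | succ k ih =>
    simp only [hermiteFun, hermiteOp_creation, ih, map_smul]
    push_cast
    module

end Eigenfunctions

section Adjoint

variable {E : Type*} [NormedAddCommGroup E] [InnerProductSpace ℝ E] [FiniteDimensional ℝ E]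
  [MeasurableSpace E] [BorelSpace E]

theorem toLp_add (φ ψ : 𝓢(E, ℂ)) :
    (φ + ψ).toLp 2 volume = φ.toLp 2 volume + ψ.toLp 2 volume :=
  map_add (SchwartzMap.toLpCLM ℂ ℂ 2 (volume : Measure E)) φ ψ

theorem toLp_sub (φ ψ : 𝓢(E, ℂ)) :
    (φ - ψ).toLp 2 volume = φ.toLp 2 volume - ψ.toLp 2 volume :=
  map_sub (SchwartzMap.toLpCLM ℂ ℂ 2 (volume : Measure E)) φ ψ

theorem toLp_neg (φ : 𝓢(E, ℂ)) : (-φ).toLp 2 volume = -φ.toLp 2 volume :=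
  map_neg (SchwartzMap.toLpCLM ℂ ℂ 2 (volume : Measure E)) φ

theorem toLp_real_smul (c : ℝ) (φ : 𝓢(E, ℂ)) :
    (c • φ).toLp 2 volume = (c : ℂ) • φ.toLp 2 volume :=
  map_smul (SchwartzMap.toLpCLM ℂ ℂ 2 (volume : Measure E)) (c : ℂ) φ

/-- The inner product of `ℂ` as a continuous real-bilinear map, the form in which the Schwartz
space library states integration by parts. -/
noncomputable def complexInner : ℂ →L[ℝ] ℂ →L[ℝ] ℂ :=
  (ContinuousLinearMap.mul ℝ ℂ).comp (conjCLE : ℂ →L[ℝ] ℂ)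

theorem inner_toLp_eq_integral (φ ψ : 𝓢(E, ℂ)) :
    ⟪φ.toLp 2 volume, ψ.toLp 2 volume⟫_ℂ = ∫ x, complexInner (φ x) (ψ x) := by
  simp [SchwartzMap.inner_toL2_toL2_eq, complexInner, mul_comm]

theorem inner_toLp_lineDerivOp_left (w : E) (φ ψ : 𝓢(E, ℂ)) :
    ⟪(∂_{w} φ).toLp 2 volume, ψ.toLp 2 volume⟫_ℂ =
      -⟪φ.toLp 2 volume, (∂_{w} ψ).toLp 2 volume⟫_ℂ := by
  rw [inner_toLp_eq_integral, inner_toLp_eq_integral,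
    SchwartzMap.integral_bilinear_lineDerivOp_right_eq_neg_left, neg_neg]

theorem inner_toLp_laplacian_left (φ ψ : 𝓢(E, ℂ)) :
    ⟪(Δ φ).toLp 2 volume, ψ.toLp 2 volume⟫_ℂ = ⟪φ.toLp 2 volume, (Δ ψ).toLp 2 volume⟫_ℂ := by
  rw [inner_toLp_eq_integral, inner_toLp_eq_integral,
    SchwartzMap.integral_bilinear_laplacian_right_eq_left]

theorem inner_toLp_mulInner_left (w : E) (φ ψ : 𝓢(E, ℂ)) :
    ⟪(mulInner w φ).toLp 2 volume, ψ.toLp 2 volume⟫_ℂ =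
      ⟪φ.toLp 2 volume, (mulInner w ψ).toLp 2 volume⟫_ℂ := by
  simp [SchwartzMap.inner_toL2_toL2_eq, mul_assoc, mul_left_comm]

theorem inner_toLp_mulNormSq_left (φ ψ : 𝓢(E, ℂ)) :
    ⟪(mulNormSq E φ).toLp 2 volume, ψ.toLp 2 volume⟫_ℂ =
      ⟪φ.toLp 2 volume, (mulNormSq E ψ).toLp 2 volume⟫_ℂ := by
  simp [SchwartzMap.inner_toL2_toL2_eq, mul_assoc, mul_left_comm]

theorem inner_toLp_creation_right (w : E) (φ ψ : 𝓢(E, ℂ)) :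
    ⟪φ.toLp 2 volume, (creation w ψ).toLp 2 volume⟫_ℂ =
      ⟪(annihilation w φ).toLp 2 volume, ψ.toLp 2 volume⟫_ℂ := by
  rw [creation_apply, annihilation_apply, toLp_sub, toLp_add, inner_sub_right, inner_add_left,
    inner_toLp_mulInner_left, inner_toLp_lineDerivOp_left, sub_eq_add_neg]

theorem norm_toLp_hermiteFun_sq (w : E) (k : ℕ) :
    ‖(hermiteFun w k).toLp 2 volume‖ ^ 2 =
      (2 * ‖w‖ ^ 2) ^ k * k.factorial * ‖(gaussian E).toLp 2 volume‖ ^ 2 := by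
  induction k with
  | zero => simp [hermiteFun]
  | succ k ih =>
    have hstep : ‖(hermiteFun w (k + 1)).toLp 2 volume‖ ^ 2 =
        2 * ‖w‖ ^ 2 * (k + 1) * ‖(hermiteFun w k).toLp 2 volume‖ ^ 2 := by
      apply ofReal_injective
      have hadj := inner_toLp_creation_right w (hermiteFun w (k + 1)) (hermiteFun w k)
      rw [annihilation_hermiteFun_succ, toLp_real_smul, inner_smul_left, conj_ofReal,
        ← hermiteFun, inner_self_eq_norm_sq_to_K, inner_self_eq_norm_sq_to_K] at hadj
      push_cast at hadj ⊢
      exact hadj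
    rw [hstep, ih, Nat.factorial_succ]
    push_cast
    ring

theorem norm_toLp_hermiteFun (w : E) (k : ℕ) :
    ‖(hermiteFun w k).toLp 2 volume‖ =
      (√2 * ‖w‖) ^ k * √(k.factorial) * ‖(gaussian E).toLp 2 volume‖ := by
  rw [← sq_eq_sq₀ (norm_nonneg _) (by positivity), norm_toLp_hermiteFun_sq,
    mul_pow _ ‖(gaussian E).toLp 2 volume‖, mul_pow _ √_, pow_right_comm, mul_pow √2,
    Real.sq_sqrt zero_le_two, Real.sq_sqrt (Nat.cast_nonneg _)]

theorem inv_factorial_mul_norm_toLp_hermiteFun (w : E) (k : ℕ) :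
    (k.factorial : ℝ)⁻¹ * ‖(hermiteFun w k).toLp 2 volume‖ =
      ‖(gaussian E).toLp 2 volume‖ * ((√2 * ‖w‖) ^ k / √(k.factorial)) := by
  have sqrt_sq : √(k.factorial) ^ 2 = k.factorial := Real.sq_sqrt (Nat.cast_nonneg _)
  rw [norm_toLp_hermiteFun]
  field_simp
  rw [sqrt_sq, mul_comm (_ ^ k)]

variable {n : ℕ}

theorem inner_toLp_hermiteOp_left (φ ψ : 𝓢(EuclideanSpace ℝ (Fin n), ℂ)) :
    ⟪(hermiteOp n φ).toLp 2 volume, ψ.toLp 2 volume⟫_ℂ =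
      ⟪φ.toLp 2 volume, (hermiteOp n ψ).toLp 2 volume⟫_ℂ := by
  simp only [hermiteOp_eq, toLp_add, toLp_neg, inner_add_left, inner_add_right, inner_neg_left,
    inner_neg_right, inner_toLp_laplacian_left, inner_toLp_mulNormSq_left]

theorem hermiteFun_mem_hermiteEigenspace (w : EuclideanSpace ℝ (Fin n)) (k : ℕ) :
    (hermiteFun w k).toLp 2 volume ∈ hermiteEigenspace n (2 * k + n) := by
  intro φ
  rw [inner_toLp_hermiteOp_left, hermiteOp_hermiteFun, toLp_real_smul, inner_smul_right]

end Adjoint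

section GeneratingFunction

variable {E : Type*} [NormedAddCommGroup E] [InnerProductSpace ℝ E]

theorem hasDerivAt_schwartz_sub_smul (φ : 𝓢(E, ℂ)) (w x : E) (t : ℝ) :
    HasDerivAt (fun s : ℝ => φ (x - s • w)) (-(∂_{w} φ) (x - t • w)) t := by
  have hline : HasDerivAt (fun s : ℝ => x - s • w) (-w) t := by
    simpa using ((hasDerivAt_id t).smul_const w).const_sub x
  simpa [SchwartzMap.lineDerivOp_apply_eq_fderiv, Function.comp_def] using
    (φ.hasFDerivAt (x - t • w)).comp_hasDerivAt t hline

-- Conjugation by the Gaussian turns the creation operator into `-∂_w`.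
theorem hasDerivAt_gaussian_mul_sub_smul (φ : 𝓢(E, ℂ)) (w x : E) (t : ℝ) :
    HasDerivAt (fun s : ℝ => gaussian E (x - s • w) * φ (x - s • w))
      (gaussian E (x - t • w) * creation w φ (x - t • w)) t := by
  refine ((hasDerivAt_schwartz_sub_smul (gaussian E) w x t).mul
    (hasDerivAt_schwartz_sub_smul φ w x t)).congr_deriv ?_
  simp only [lineDerivOp_gaussian, creation_apply, _root_.sub_apply, _root_.neg_apply,
    mulInner_apply]
  ring

theorem gaussian_sq_sub_smul (w x : E) (t : ℝ) :
    gaussian E (x - t • w) * gaussian E (x - t • w) =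
      cexp (2 * t * ⟪w, x⟫_ℝ - t ^ 2 * ‖w‖ ^ 2) * (gaussian E x * gaussian E x) := by
  simp only [gaussian_apply, ofReal_exp, ← Complex.exp_add]
  congr 1
  norm_cast
  rw [norm_sub_sq_real, norm_smul, mul_pow, Real.norm_eq_abs, sq_abs, real_inner_smul_right,
    real_inner_comm]
  ring

theorem iteratedDeriv_cexp_mul_gaussian_sq (w x : E) (k : ℕ) (t : ℝ) :
    iteratedDeriv k (fun z : ℂ => cexp (2 * z * ⟪w, x⟫_ℝ - z ^ 2 * ‖w‖ ^ 2) *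
        (gaussian E x * gaussian E x)) t =
      gaussian E (x - t • w) * hermiteFun w k (x - t • w) := by
  induction k generalizing t with
  | zero => rw [iteratedDeriv_zero, hermiteFun, gaussian_sq_sub_smul]
  | succ k ih =>
    have hdiff := ContDiff.differentiable_iteratedDeriv k
      (f := fun z : ℂ => cexp (2 * z * ⟪w, x⟫_ℝ - z ^ 2 * ‖w‖ ^ 2) *
        (gaussian E x * gaussian E x)) (n := ω) (by fun_prop) (WithTop.coe_lt_top _)
    have hreal := (hdiff t).hasDerivAt.comp_ofReal
    simp only [ih] at hreal
    rw [iteratedDeriv_succ, hermiteFun]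
    exact hreal.unique (hasDerivAt_gaussian_mul_sub_smul _ w x t)

theorem hasSum_pow_smul_hermiteFun (w x : E) (z : ℂ) :
    HasSum (fun k => z ^ k • ((k.factorial : ℂ)⁻¹ * hermiteFun w k x))
      (cexp (2 * z * ⟪w, x⟫_ℝ - z ^ 2 * ‖w‖ ^ 2) * gaussian E x) := by
  have htaylor := Complex.hasSum_taylorSeries_of_entire
    (f := fun z : ℂ => cexp (2 * z * ⟪w, x⟫_ℝ - z ^ 2 * ‖w‖ ^ 2) *
      (gaussian E x * gaussian E x)) (by fun_prop) 0 z
  have hderiv (k : ℕ) := iteratedDeriv_cexp_mul_gaussian_sq w x k 0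
  simp only [ofReal_zero, zero_smul, sub_zero] at hderiv
  simp only [hderiv, sub_zero] at htaylor
  refine (hasSum_mul_right_iff (gaussian_ne_zero x)).1 ?_
  simpa only [smul_eq_mul, mul_assoc, mul_comm, mul_left_comm] using htaylor

end GeneratingFunction

section BargmannTransform

theorem integral_norm_inner_le {α : Type*} [MeasurableSpace α] {μ : Measure α}
    {E 𝕜 : Type*} [RCLike 𝕜] [NormedAddCommGroup E] [InnerProductSpace 𝕜 E] (f g : Lp E 2 μ) :
    ∫ x, ‖⟪f x, g x⟫_𝕜‖ ∂μ ≤ ‖f‖ * ‖g‖ := by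
  have holder := eLpNorm_le_eLpNorm_mul_eLpNorm'_of_norm (p := 2) (q := 2) (r := 1)
    (Lp.aestronglyMeasurable f) (Lp.aestronglyMeasurable g) (fun x y : E => ⟪x, y⟫_𝕜) 1
    (Filter.Eventually.of_forall fun x => by simpa using norm_inner_le_norm (𝕜 := 𝕜) (f x) (g x))
  rw [integral_norm_eq_lintegral_enorm (L2.integrable_inner f g).aestronglyMeasurable,
    ← eLpNorm_one_eq_lintegral_enorm, Lp.norm_def, Lp.norm_def, ← ENNReal.toReal_mul]
  refine ENNReal.toReal_mono (ENNReal.mul_ne_top (Lp.eLpNorm_ne_top f) (Lp.eLpNorm_ne_top g)) ?_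
  simpa using holder

theorem norm_inner_le_norm_starProjection {𝕜 H : Type*} [RCLike 𝕜] [NormedAddCommGroup H]
    [InnerProductSpace 𝕜 H] (U : Submodule 𝕜 H) [U.HasOrthogonalProjection] (f : H) {g : H}
    (hg : g ∈ U) : ‖⟪f, g⟫_𝕜‖ ≤ ‖U.starProjection f‖ * ‖g‖ := by
  rw [← Submodule.starProjection_eq_self_iff.2 hg, ← Submodule.inner_starProjection_left_eq_right,
    Submodule.starProjection_eq_self_iff.2 hg]
  exact norm_inner_le_norm _ _

variable {E : Type*} [NormedAddCommGroup E] [InnerProductSpace ℝ E] [FiniteDimensional ℝ E]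
  [MeasurableSpace E] [BorelSpace E]

/-- The Bargmann transform of `f` in direction `w`: the pairing of `f` with the coherent states
`exp (2 z ⟪w, x⟫ - z ^ 2 ‖w‖ ^ 2) exp (-‖x‖ ^ 2 / 2)`. Taking the conjugate of `f` makes it
holomorphic in `z`. -/
noncomputable def bargmannTransform (f : Lp ℂ 2 (volume : Measure E)) (w : E) (z : ℂ) : ℂ :=
  ∫ x, cexp (2 * z * ⟪w, x⟫_ℝ - z ^ 2 * ‖w‖ ^ 2) * (gaussian E x * starRingEnd ℂ (f x))

variable (f : Lp ℂ 2 (volume : Measure E)) (w : E)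

theorem hasSum_bargmannTransform (z : ℂ) :
    HasSum (fun k => z ^ k •
      ((k.factorial : ℂ)⁻¹ * ⟪f, (hermiteFun w k).toLp 2 volume⟫_ℂ)) (bargmannTransform f w z) := by
  have hint (k : ℕ) : Integrable fun x =>
      z ^ k • ((k.factorial : ℂ)⁻¹ * ⟪f x, (hermiteFun w k).toLp 2 volume x⟫_ℂ) :=
    ((L2.integrable_inner f _).const_mul _).fun_smul _
  have hsummable : Summable fun k : ℕ => ∫ x,
      ‖z ^ k • ((k.factorial : ℂ)⁻¹ * ⟪f x, (hermiteFun w k).toLp 2 volume x⟫_ℂ)‖ := by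
    refine .of_nonneg_of_le (fun k => integral_nonneg fun x => norm_nonneg _) (fun k => ?_)
      ((summable_pow_div_sqrt_factorial (√2 * ‖w‖ * ‖z‖)).mul_left
        (‖f‖ * ‖(gaussian E).toLp 2 volume‖))
    simp only [norm_smul, norm_mul, norm_pow, norm_inv, RCLike.norm_natCast, integral_const_mul]
    calc ‖z‖ ^ k * ((k.factorial : ℝ)⁻¹ * ∫ x, ‖⟪f x, (hermiteFun w k).toLp 2 volume x⟫_ℂ‖)
        ≤ ‖z‖ ^ k * ((k.factorial : ℝ)⁻¹ * (‖f‖ * ‖(hermiteFun w k).toLp 2 volume‖)) := by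
          gcongr
          exact integral_norm_inner_le _ _
      _ = ‖f‖ * ‖z‖ ^ k * ((k.factorial : ℝ)⁻¹ * ‖(hermiteFun w k).toLp 2 volume‖) := by ring
      _ = ‖f‖ * ‖(gaussian E).toLp 2 volume‖ * ((√2 * ‖w‖ * ‖z‖) ^ k / √(k.factorial)) := by
          rw [inv_factorial_mul_norm_toLp_hermiteFun]
          ring
  have hsum := hasSum_integral_of_summable_integral_norm hint hsummable
  simp only [integral_smul, integral_const_mul, ← L2.inner_def] at hsum
  convert! hsum using 1
  refine integral_congr_ae ?_
  filter_upwards [ae_all_iff.2 fun k => (hermiteFun w k).coeFn_toLp 2 volume] with x hx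
  rw [← mul_assoc, ← ((hasSum_pow_smul_hermiteFun w x z).mul_right _).tsum_eq]
  simp only [hx, RCLike.inner_apply, smul_eq_mul, mul_assoc]

theorem differentiable_bargmannTransform : Differentiable ℂ (bargmannTransform f w) :=
  differentiable_of_hasSum_pow_smul (hasSum_bargmannTransform f w)

theorem integrable_rexp_neg_mul_sq_norm_add {b : ℝ} (hb : 0 < b) (c : ℝ) :
    Integrable fun x : E => rexp (-b * ‖x‖ ^ 2 + c * ⟪w, x⟫_ℝ) := by
  have hcomplex := (GaussianFourier.integrable_cexp_neg_mul_sq_norm_add (b := b)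
    (by simpa using hb) c w).norm
  norm_cast at hcomplex
  simpa only [norm_real, Real.norm_eq_abs, Real.abs_exp] using hcomplex

theorem integral_rexp_neg_mul_sq_norm_add {b : ℝ} (hb : 0 < b) (c : ℝ) :
    ∫ x : E, rexp (-b * ‖x‖ ^ 2 + c * ⟪w, x⟫_ℝ) =
      (π / b) ^ (Module.finrank ℝ E / 2 : ℝ) * rexp (c ^ 2 * ‖w‖ ^ 2 / (4 * b)) := by
  apply ofReal_injective
  rw [← integral_complex_ofReal, ofReal_mul, ofReal_cpow (by positivity)]
  push_cast
  exact GaussianFourier.integral_cexp_neg_mul_sq_norm_add (by simpa using hb) c w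

theorem norm_bargmannTransform_ofReal_le {f : Lp ℂ 2 (volume : Measure E)} {a C : ℝ} (ha : -1 < a)
    (hf : ∀ᵐ x, ‖f x‖ ≤ C * rexp (-(1 / 2) * a * ‖x‖ ^ 2)) (t : ℝ) :
    ‖bargmannTransform f w t‖ ≤ C * (π / ((1 + a) / 2)) ^ (Module.finrank ℝ E / 2 : ℝ) *
      rexp (-((a - 1) / (a + 1) * ‖w‖ ^ 2) * t ^ 2) := by
  have ha' : 0 < 1 + a := by linarith
  have hint := (integrable_rexp_neg_mul_sq_norm_add w (half_pos ha') (2 * t)).const_mul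
    (C * rexp (-(t ^ 2 * ‖w‖ ^ 2)))
  have hle : ∀ᵐ x, ‖cexp (2 * t * ⟪w, x⟫_ℝ - t ^ 2 * ‖w‖ ^ 2) *
      (gaussian E x * starRingEnd ℂ (f x))‖ ≤ C * rexp (-(t ^ 2 * ‖w‖ ^ 2)) *
        rexp (-((1 + a) / 2) * ‖x‖ ^ 2 + 2 * t * ⟪w, x⟫_ℝ) := by
    filter_upwards [hf] with x hx
    have norm_coherent : ‖cexp (2 * t * ⟪w, x⟫_ℝ - t ^ 2 * ‖w‖ ^ 2)‖ =
        rexp (2 * t * ⟪w, x⟫_ℝ - t ^ 2 * ‖w‖ ^ 2) := by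
      rw [← norm_exp_ofReal]
      push_cast
      rfl
    rw [norm_mul, norm_mul, norm_coherent, gaussian_apply, norm_real, Real.norm_eq_abs,
      Real.abs_exp, RCLike.norm_conj]
    refine (by gcongr : _ ≤ _ * (_ * (C * rexp (-(1 / 2) * a * ‖x‖ ^ 2)))).trans_eq ?_
    rw [mul_left_comm _ C, mul_left_comm _ C, mul_assoc C, ← Real.exp_add, ← Real.exp_add,
      ← Real.exp_add]
    ring_nf
  refine (norm_integral_le_of_norm_le hint hle).trans_eq ?_
  rw [integral_const_mul, integral_rexp_neg_mul_sq_norm_add w (half_pos ha'), mul_mul_mul_comm,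
    ← Real.exp_add]
  congr 2
  rw [add_comm 1 a] at ha' ⊢
  field_simp
  ring

open FourierTransform in
theorem ae_eq_zero_of_fourier_eq_zero {F : Type*} [NormedAddCommGroup F] [NormedSpace ℂ F]
    [CompleteSpace F] {u : E → F} (hu : Integrable u) (hfourier : 𝓕 u = 0) : u =ᵐ[volume] 0 := by
  refine ae_eq_zero_of_integral_contDiff_smul_eq_zero hu.locallyIntegrable fun g hg hgsupp => ?_
  let ψ : 𝓢(E, ℂ) := (hgsupp.comp_left ofReal_zero).toSchwartzMap (ofRealCLM.contDiff.comp hg)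
  calc ∫ x, g x • u x = ∫ x, 𝓕 (𝓕⁻ ψ) x • u x := by
        rw [FourierTransform.fourier_fourierInv_eq]
        rfl
    _ = ∫ x, 𝓕⁻ ψ x • 𝓕 u x := by
        simpa only [flip_innerₗ] using! VectorFourier.integral_fourierIntegral_smul_eq_flip
          (L := innerₗ E) Real.continuous_fourierChar continuous_inner (𝓕⁻ ψ).integrable hu
    _ = 0 := by simp only [hfourier, Pi.zero_apply, smul_zero, integral_zero]

theorem integrable_gaussian_mul_conj : Integrable fun x => gaussian E x * starRingEnd ℂ (f x) := by
  refine (L2.integrable_inner (𝕜 := ℂ) f ((gaussian E).toLp 2 volume)).congr ?_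
  filter_upwards [(gaussian E).coeFn_toLp 2 volume] with x hx
  rw [hx, RCLike.inner_apply]

open FourierTransform in
theorem bargmannTransform_neg_pi_smul_I (ξ : E) :
    bargmannTransform f (-π • ξ) I = cexp (‖-π • ξ‖ ^ 2) *
      𝓕 (fun x => gaussian E x * starRingEnd ℂ (f x)) ξ := by
  rw [bargmannTransform, Real.fourier_eq', ← integral_const_mul]
  congr with x
  rw [smul_eq_mul, ← mul_assoc (cexp _) (cexp _), ← Complex.exp_add, real_inner_smul_left,
    real_inner_comm, I_sq]
  push_cast
  ring_nf

theorem eq_zero_of_bargmannTransform_I_eq_zero (hzero : ∀ w, bargmannTransform f w I = 0) :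
    f = 0 := by
  have hfourier := ae_eq_zero_of_fourier_eq_zero (integrable_gaussian_mul_conj f) <|
    funext fun ξ => by
      simpa only [bargmannTransform_neg_pi_smul_I, mul_eq_zero, Complex.exp_ne_zero, false_or,
        Pi.zero_apply] using hzero (-π • ξ)
  rw [Lp.eq_zero_iff_ae_eq_zero]
  filter_upwards [hfourier] with x hx
  simpa [gaussian_ne_zero] using hx

end BargmannTransform

section Hardy

theorem one_lt_mul_tanh_iff {a b : ℝ} (ha : -1 < a) :
    1 < a * Real.tanh b ↔ rexp (-b) ^ 2 < (a - 1) / (a + 1) := by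
  have tanh_eq : Real.tanh b = (1 - rexp (-b) ^ 2) / (1 + rexp (-b) ^ 2) := by
    rw [Real.tanh_eq, Real.exp_neg]
    field_simp
  rw [tanh_eq, ← mul_div_assoc, lt_div_iff₀ (by positivity), lt_div_iff₀ (by linarith)]
  constructor <;> intro h <;> linarith

variable {n : ℕ} {f : L2 n} {w : EuclideanSpace ℝ (Fin n)} {a b C₁ C₂ : ℝ}

theorem norm_inv_factorial_mul_inner_hermiteFun_le (f : L2 n) (w : EuclideanSpace ℝ (Fin n))
    (k : ℕ) :
    ‖(k.factorial : ℂ)⁻¹ * ⟪f, (hermiteFun w k).toLp 2 volume⟫_ℂ‖ ≤ ‖hermiteProj n k f‖ *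
      (‖(gaussian (EuclideanSpace ℝ (Fin n))).toLp 2 volume‖ *
        ((√2 * ‖w‖) ^ k / √(k.factorial))) := by
  rw [norm_mul, norm_inv, RCLike.norm_natCast, ← inv_factorial_mul_norm_toLp_hermiteFun,
    mul_left_comm]
  gcongr
  exact norm_inner_le_norm_starProjection _ f (hermiteFun_mem_hermiteEigenspace w k)

theorem norm_bargmannTransform_le
    (hPf : ∀ k : ℕ, ‖hermiteProj n k f‖ ≤ C₂ * rexp (-(1 / 2) * b * (2 * k + n)))
    {θ : ℝ} (hθ : 0 < θ) (hθ1 : θ < 1) (z : ℂ) :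
    ‖bargmannTransform f w z‖ ≤ C₂ * rexp (-(1 / 2) * b * n) *
      ‖(gaussian (EuclideanSpace ℝ (Fin n))).toLp 2 volume‖ * (1 - θ)⁻¹ *
        rexp (rexp (-b) ^ 2 / θ ^ 2 * ‖w‖ ^ 2 * ‖z‖ ^ 2) := by
  have exp_eq (k : ℕ) : rexp (-(1 / 2) * b * (2 * k + n)) =
      rexp (-(1 / 2) * b * n) * rexp (-b) ^ k := by
    rw [← Real.exp_nat_mul, ← Real.exp_add]
    ring_nf
  have hcoeff (k : ℕ) : ‖(k.factorial : ℂ)⁻¹ * ⟪f, (hermiteFun w k).toLp 2 volume⟫_ℂ‖ ≤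
      C₂ * rexp (-(1 / 2) * b * n) * ‖(gaussian (EuclideanSpace ℝ (Fin n))).toLp 2 volume‖ *
        ((rexp (-b) * (√2 * ‖w‖)) ^ k / √(k.factorial)) := by
    refine (norm_inv_factorial_mul_inner_hermiteFun_le f w k).trans
      ((mul_le_mul_of_nonneg_right (hPf k) (by positivity)).trans_eq ?_)
    rw [exp_eq]
    ring
  refine (norm_le_of_hasSum_pow_smul (hasSum_bargmannTransform f w) hcoeff hθ hθ1 z).trans_eq ?_
  rw [mul_pow, mul_pow, Real.sq_sqrt zero_le_two]
  field_simp

theorem bargmannTransform_eq_zero (hw : w ≠ 0) (ha : -1 < a)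
    (hf : ∀ᵐ x, ‖f x‖ ≤ C₁ * rexp (-(1 / 2) * a * ‖x‖ ^ 2))
    (hPf : ∀ k : ℕ, ‖hermiteProj n k f‖ ≤ C₂ * rexp (-(1 / 2) * b * (2 * k + n)))
    (hab : 1 < a * Real.tanh b) : bargmannTransform f w = 0 := by
  have hlt := (one_lt_mul_tanh_iff ha).1 hab
  have hpos : 0 < (a - 1) / (a + 1) := (by positivity : 0 < rexp (-b) ^ 2).trans hlt
  obtain ⟨θ, hθ, hθ1⟩ : ∃ θ, √(rexp (-b) ^ 2 / ((a - 1) / (a + 1))) < θ ∧ θ < 1 :=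
    exists_between ((Real.sqrt_lt' one_pos).2 (by rwa [one_pow, div_lt_one hpos]))
  have hθ0 : 0 < θ := (Real.sqrt_nonneg _).trans_lt hθ
  refine eq_zero_of_gaussian_decay_of_gaussian_growth (differentiable_bargmannTransform f w)
    (norm_bargmannTransform_le hPf hθ0 hθ1)
    (fun t _ => norm_bargmannTransform_ofReal_le w ha hf t) ?_
  refine mul_lt_mul_of_pos_right ?_ (by positivity)
  rwa [Real.sqrt_lt' hθ0, div_lt_comm₀ hpos (by positivity)] at hθ

theorem bargmannTransform_zero_left (f : L2 n) (w : EuclideanSpace ℝ (Fin n)) (z : ℂ) :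
    bargmannTransform f 0 z = bargmannTransform f w 0 := by
  simp [bargmannTransform]

end Hardy

end HermiteExpansion

theorem mainTheorem6 (n : ℕ) (hn : 1 ≤ n) (f : HermiteExpansion.L2 n) (a b C : ℝ)
    (ha : 0 < a) (hb : 0 < b)
    (hf : ∀ᵐ x : EuclideanSpace ℝ (Fin n), ‖f x‖ ≤ C * Real.exp (-(1 / 2) * a * ‖x‖ ^ 2))
    (hPf : ∀ k : ℕ, ‖HermiteExpansion.hermiteProj n k f‖ ≤
      C * Real.exp (-(1 / 2) * b * (2 * (k : ℝ) + (n : ℝ))))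
    (hab : 1 < a * Real.tanh b) :
    f = 0 := by
  open HermiteExpansion in
  have : NeZero n := ⟨by omega⟩
  obtain ⟨v, hv⟩ := exists_ne (0 : EuclideanSpace ℝ (Fin n))
  have vanishes {w} (hw : w ≠ 0) : bargmannTransform f w = 0 :=
    bargmannTransform_eq_zero hw (by linarith) hf hPf hab
  refine eq_zero_of_bargmannTransform_I_eq_zero f fun w => ?_
  obtain rfl | hw := eq_or_ne w 0
  · rw [bargmannTransform_zero_left f v, vanishes hv, Pi.zero_apply]
  · rw [vanishes hw, Pi.zero_apply]
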